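/- A (possibly partial) Boolean function is a map $f:\{0,1\}^n\to\{0,1,*\}$ with domain $\mathrm{Dom}(f)=\{x : f(x)\neq *\}$. Let $\mathrm{D}(f)$ be its deterministic query complexity, i.e. the least depth of a deterministic decision tree (querying one input bit per node) that outputs $f(x)$ on every $x\in\mathrm{Dom}(f)$. Let $\widetilde{\deg}(f)$ be its approximate degree, i.e. the least degree of a real polynomial $p$ in $n$ variables such that $|p(x)-f(x)|\le 1/3$ for all $x\in\mathrm{Dom}(f)$ and $p(x)\in[0,1]$ for all $x\in\{0,1\}^n$. **Lemma.** For every (possibly partial) Boolean function $f$, $$\mathrm{D}(f)=O\big(\widetilde{\deg}(f)^2\cdot\log^2|\mathrm{Dom}(f)|\big).$$ That is, there is an absolute constant $C>0$ such that for every $n$ and every $f:\{0,1\}^n\to\{0,1,*\}$ one has $\mathrm{D}(f)\le C\cdot\widetilde{\deg}(f)^2\cdot\big(\log_2|\mathrm{Dom}(f)|\big)^2$, where for the nowhere defined function, $\mathrm{Dom}(f)=\emptyset$, the right-hand side is read as $0$. -/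

import Mathlib

/-- A possibly partial Boolean function on `n` bits, i.e. a map `{0,1}ⁿ → {0,1,*}`;
the value `none` stands for `*` (the input is outside the promise). -/
abbrev PartialBoolFun (n : ℕ) : Type := (Fin n → Bool) → Option Bool

/-- The domain `Dom(f)`: the inputs on which `f` is defined. -/
def PartialBoolFun.dom {n : ℕ} (f : PartialBoolFun n) : Finset (Fin n → Bool) :=
  Finset.univ.filter fun x => (f x).isSome = true

/-- Deterministic decision trees on `n` input bits. -/
inductive DecisionTree (n : ℕ) : Type
  /-- A leaf, labelled by the output bit. -/
  | leaf (b : Bool) : DecisionTree n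
  /-- An internal node querying bit `i`; `t₀` is followed if it is `0` and `t₁` if it is `1`. -/
  | query (i : Fin n) (t₀ t₁ : DecisionTree n) : DecisionTree n

namespace DecisionTree

/-- The output of the tree on the input `x`. -/
def eval {n : ℕ} : DecisionTree n → (Fin n → Bool) → Bool
  | leaf b, _ => b
  | query i t₀ t₁, x => if x i = true then t₁.eval x else t₀.eval x

/-- The worst-case number of queries. -/
def depth {n : ℕ} : DecisionTree n → ℕ
  | leaf _ => 0
  | query _ t₀ t₁ => max t₀.depth t₁.depth + 1

/-- The tree outputs `f x` on every `x` in the domain of `f`; outside it, its output is free. -/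
def Computes {n : ℕ} (T : DecisionTree n) (f : PartialBoolFun n) : Prop :=
  ∀ (x : Fin n → Bool) (b : Bool), f x = some b → T.eval x = b

end DecisionTree

/-- Deterministic query complexity `D(f)`: the least depth of a decision tree computing `f`. -/
noncomputable def detQueryComplexity {n : ℕ} (f : PartialBoolFun n) : ℕ :=
  sInf {d : ℕ | ∃ T : DecisionTree n, T.Computes f ∧ T.depth = d}

/-- A bit as a real number. -/
def bitReal (b : Bool) : ℝ := if b = true then 1 else 0

/-- The value of a real polynomial at a point of the Boolean cube. -/
noncomputable def evalBits {n : ℕ} (p : MvPolynomial (Fin n) ℝ) (x : Fin n → Bool) : ℝ :=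
  MvPolynomial.eval (fun i => bitReal (x i)) p

/-- `p` approximates `f` to error `ε` on `Dom(f)` and is bounded in `[0,1]` on the whole cube. -/
def ApproximatesBounded {n : ℕ} (ε : ℝ) (p : MvPolynomial (Fin n) ℝ) (f : PartialBoolFun n) :
    Prop :=
  (∀ (x : Fin n → Bool) (b : Bool), f x = some b → |evalBits p x - bitReal b| ≤ ε) ∧
    ∀ x : Fin n → Bool, evalBits p x ∈ Set.Icc (0 : ℝ) 1

/-- The `ε`-approximate degree of a possibly partial Boolean function. -/
noncomputable def approxDegreeWithError {n : ℕ} (ε : ℝ) (f : PartialBoolFun n) : ℕ :=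
  sInf {d : ℕ | ∃ p : MvPolynomial (Fin n) ℝ, ApproximatesBounded ε p f ∧ p.totalDegree = d}

/-- The approximate degree, with the usual error `1/3`. -/
noncomputable def approxDegree {n : ℕ} (f : PartialBoolFun n) : ℕ :=
  approxDegreeWithError (1 / 3) f

/-! Keep the sets A₀, A₁ of 0-inputs and 1-inputs consistent with the answers so far; the potential
is |A₀|·|A₁|. Let p be an optimal approximant, of degree d. For any point z of the cube, p(z) lies
on one side of 1/2, hence at distance at least 1/6 from p on all of some A_c. Then some coordinate
separates z from a fraction 1/(96d²) of A_c (`exists_card_le_mul_card_filter_ne`). For this, let m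
be the largest number of points of A_c that differ from z in one coordinate. Substituting Chebyshev
step polynomials of degree O(√m) into p gives a bounded polynomial on {0,1}^A, of degree O(d√m),
whose value is p(z) at the origin and p(y) at the unit vector of y. By Markov's inequality the
increments from the origin sum to O(d²m), yet each is at least 1/6. If every query had an answer
that hardly shrinks the potential, those answers would form a point z contradicting this
(`exists_query_shrinking`). So good queries exist and O(d² log|Dom f|) of them suffice; the second
logarithm is only slack. -/

/-! ### Univariate tools: Markov and Chebyshev -/

open Polynomial in
/-- Markov's inequality at the left endpoint, for a polynomial mapping `[0, 1]` to itself. -/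
theorem eval_zero_derivative_le_sq {D : ℕ} {R : ℝ[X]} (hdeg : R.natDegree ≤ D)
    (hR : ∀ t ∈ Set.Icc (0 : ℝ) 1, R.eval t ∈ Set.Icc (0 : ℝ) 1) :
    (derivative R).eval 0 ≤ (D : ℝ) ^ 2 := by
  -- The affine changes carry [0, 1] to [-1, 1] with 0 sent to the endpoint 1; their factors -2 and
  -- -1/2 cancel in the derivative.
  set P : ℝ[X] := 1 - C 2 * R.comp (C (1 / 2) - C (1 / 2) * X) with hP
  have hlin : (C (1 / 2) - C (1 / 2) * X : ℝ[X]).natDegree ≤ 1 := by compute_degree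
  have hdegP : P.degree ≤ D := by
    apply natDegree_le_iff_degree_le.mp
    refine (natDegree_sub_le _ _).trans (max_le (by simp) ?_)
    refine (natDegree_C_mul_le _ _).trans (natDegree_comp_le.trans ?_)
    exact (Nat.mul_le_mul hdeg hlin).trans_eq (mul_one D)
  have hbnd : ∀ x ∈ Set.Icc (-1 : ℝ) 1, |P.eval x| ≤ 1 := by
    rintro x ⟨h1, h2⟩
    obtain ⟨h3, h4⟩ := hR (1 / 2 - 1 / 2 * x) ⟨by linarith, by linarith⟩
    simp only [hP, eval_sub, eval_one, eval_mul, eval_C, eval_comp, eval_X]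
    rw [abs_le]
    constructor <;> linarith
  have key := Chebyshev.eval_iterate_derivative_le_of_forall_abs_le_one (k := 1) le_rfl hdegP hbnd
  have h1 : (derivative P).eval 1 = (derivative R).eval 0 := by
    simp [hP, derivative_comp]
  have h2 : (derivative (Chebyshev.T ℝ D)).eval 1 = (D : ℝ) ^ 2 := by
    rw [Chebyshev.T_derivative_eq_U]
    simp [Chebyshev.U_eval_one]
    ring
  simpa [h1, h2] using key

open Polynomial in
/-- A polynomial of degree `O(√m)` that equals `0` at `0`, equals `1` at `1` and maps `[0, m]`
to `[0, 1]`. -/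
theorem exists_polynomial_step {k m : ℕ} (hk : k ≠ 0) (hm : 4 * m ≤ k ^ 2) :
    ∃ q : ℝ[X], q.natDegree ≤ k ∧ q.eval 0 = 0 ∧ q.eval 1 = 1 ∧
      ∀ t ∈ Set.Icc (0 : ℝ) m, q.eval t ∈ Set.Icc (0 : ℝ) 1 := by
  have hk0 : (0 : ℝ) < k := by positivity
  -- `t ↦ 1 - a * t` sends 0 and 1 to 1 and cos(π/k), adjacent extrema of T_k with values 1 and -1.
  -- As a ≤ π²/(2k²) ≤ 8/k², it keeps [0, m] inside [-1, 1].
  set a : ℝ := 1 - Real.cos (Real.pi / k) with ha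
  have ha0 : 0 ≤ a := by linarith [Real.cos_le_one (Real.pi / k)]
  have ham : a * m ≤ 2 := by
    have h1 : a ≤ 8 / (k : ℝ) ^ 2 := by
      have h2 := Real.one_sub_sq_div_two_le_cos (x := Real.pi / k)
      have h3 : (Real.pi / k) ^ 2 / 2 ≤ 8 / (k : ℝ) ^ 2 := by
        rw [div_pow, div_div, div_le_div_iff₀ (by positivity) (by positivity)]
        have : Real.pi ^ 2 ≤ 16 := by nlinarith [Real.pi_le_four, Real.pi_pos]
        nlinarith [sq_nonneg (k : ℝ)]
      linarith
    have h4 : (4 : ℝ) * m ≤ (k : ℝ) ^ 2 := by exact_mod_cast hm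
    calc a * m ≤ 8 / (k : ℝ) ^ 2 * m := by gcongr
      _ ≤ 2 := by
        rw [div_mul_eq_mul_div, div_le_iff₀ (by positivity)]
        linarith
  refine ⟨C (1 / 2) - C (1 / 2) * (Chebyshev.T ℝ k).comp (1 - C a * X), ?_, ?_, ?_, ?_⟩
  · have hlin : (1 - C a * X : ℝ[X]).natDegree ≤ 1 := by compute_degree
    refine (natDegree_sub_le _ _).trans (max_le (by simp) ?_)
    refine (natDegree_C_mul_le _ _).trans (natDegree_comp_le.trans ?_)
    rw [Chebyshev.natDegree_T]
    simpa using Nat.mul_le_mul_left k hlin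
  · simp
  · have h : (Chebyshev.T ℝ k).eval (1 - a) = -1 := by
      have h5 : (1 - a) = Real.cos (Real.pi / k) := by rw [ha]; ring
      rw [h5, Chebyshev.T_real_cos]
      have h6 : ((k : ℤ) : ℝ) * (Real.pi / k) = Real.pi := by
        push_cast
        field_simp
      rw [h6, Real.cos_pi]
    simp [h]
    norm_num
  · rintro t ⟨ht0, htm⟩
    have h7 : a * t ≤ 2 := (mul_le_mul_of_nonneg_left htm ha0).trans ham
    have h8 : 0 ≤ a * t := mul_nonneg ha0 ht0
    obtain ⟨h9, h10⟩ := Chebyshev.eval_T_real_mem_Icc k (x := 1 - a * t)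
      ⟨by linarith, by linarith⟩
    simp only [eval_sub, eval_one, eval_mul, eval_C, eval_comp, eval_X]
    exact ⟨by linarith, by linarith⟩

open Polynomial in
theorem totalDegree_polynomial_aeval_le {σ : Type*} (L : MvPolynomial σ ℝ) (q : ℝ[X]) :
    (aeval L q).totalDegree ≤ q.natDegree * L.totalDegree := by
  rw [aeval_eq_sum_range]
  refine MvPolynomial.totalDegree_finsetSum_le fun i hi => ?_
  refine (MvPolynomial.totalDegree_smul_le _ _).trans ((MvPolynomial.totalDegree_pow _ _).trans ?_)
  exact Nat.mul_le_mul_right _ (Nat.lt_succ_iff.mp (Finset.mem_range.mp hi))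

/-! ### Multilinear extensions and Markov's inequality on the cube -/

/-- The multilinear polynomial function with coefficients `c`. -/
noncomputable def multilinearEval {ι : Type*} [Fintype ι] [DecidableEq ι] (c : Finset ι → ℝ)
    (u : ι → ℝ) : ℝ :=
  ∑ S : Finset ι, c S * ∏ i ∈ S, u i

/-- On the Boolean cube every polynomial agrees with a multilinear one of no larger degree. -/
theorem exists_multilinearEval {ι : Type*} [Fintype ι] [DecidableEq ι] (P : MvPolynomial ι ℝ) :
    ∃ c : Finset ι → ℝ, (∀ S, P.totalDegree < S.card → c S = 0) ∧
      ∀ x : ι → Bool, MvPolynomial.eval (fun i => bitReal (x i)) P =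
        multilinearEval c fun i => bitReal (x i) := by
  refine ⟨fun S => ∑ m ∈ P.support with m.support = S, P.coeff m, fun S hS => ?_, fun x => ?_⟩
  · refine Finset.sum_eq_zero fun m hm => ?_
    obtain ⟨hmP, rfl⟩ := Finset.mem_filter.mp hm
    have h1 : m.support.card ≤ m.sum fun _ e => e := by
      rw [Finset.card_eq_sum_ones]
      exact Finset.sum_le_sum fun i hi => Nat.one_le_iff_ne_zero.mpr (Finsupp.mem_support_iff.mp hi)
    exact absurd (h1.trans (MvPolynomial.le_totalDegree hmP)) (not_le.mpr hS)
  · rw [MvPolynomial.eval_eq, multilinearEval]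
    simp_rw [Finset.sum_mul]
    rw [← Finset.sum_fiberwise P.support (fun m => m.support)]
    refine Finset.sum_congr rfl fun S _ => Finset.sum_congr rfl fun m hm => ?_
    obtain ⟨-, rfl⟩ := Finset.mem_filter.mp hm
    congr 1
    refine Finset.prod_congr rfl fun i hi => ?_
    have := Finsupp.mem_support_iff.mp hi
    cases x i <;> simp [bitReal, this]

/-- The value of a multilinear polynomial is the mean of its values at independent random bits. -/
theorem multilinearEval_eq_sum {ι : Type*} [Fintype ι] [DecidableEq ι] (c : Finset ι → ℝ)
    (u : ι → ℝ) :
    multilinearEval c u = ∑ x : ι → Bool, (∏ i, if x i = true then u i else 1 - u i) *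
      multilinearEval c fun i => bitReal (x i) := by
  have mono (S : Finset ι) : ∏ i ∈ S, u i = ∑ x : ι → Bool,
      (∏ i, if x i = true then u i else 1 - u i) * ∏ i ∈ S, bitReal (x i) := by
    have h1 (x : ι → Bool) : (∏ i, if x i = true then u i else 1 - u i) * ∏ i ∈ S, bitReal (x i)
        = ∏ i, (if x i = true then u i else 1 - u i) * (if i ∈ S then bitReal (x i) else 1) := by
      rw [Finset.prod_mul_distrib, Finset.prod_ite_mem, Finset.univ_inter]
    simp_rw [h1]
    have h2 := Finset.prod_univ_sum (fun _ : ι => (Finset.univ : Finset Bool)) fun i b =>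
      (if b = true then u i else 1 - u i) * (if i ∈ S then bitReal b else 1)
    rw [Fintype.piFinset_univ] at h2
    rw [← h2, ← Finset.univ_inter S, ← Finset.prod_ite_mem]
    refine Finset.prod_congr rfl fun i _ => ?_
    by_cases hi : i ∈ S <;> simp [hi, bitReal]
  simp only [multilinearEval, mono, Finset.mul_sum]
  rw [Finset.sum_comm]
  exact Finset.sum_congr rfl fun x _ => Finset.sum_congr rfl fun S _ => by ring

/-- A mean of values in [0, 1] stays in [0, 1]. This is why p is replaced by its multilinear form
before non-Boolean values are substituted. -/
theorem multilinearEval_mem_Icc {ι : Type*} [Fintype ι] [DecidableEq ι] {c : Finset ι → ℝ}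
    (hc : ∀ x : ι → Bool, (multilinearEval c fun i => bitReal (x i)) ∈ Set.Icc (0 : ℝ) 1)
    {u : ι → ℝ} (hu : ∀ i, u i ∈ Set.Icc (0 : ℝ) 1) : multilinearEval c u ∈ Set.Icc (0 : ℝ) 1 := by
  have hw (x : ι → Bool) : 0 ≤ ∏ i, if x i = true then u i else 1 - u i :=
    Finset.prod_nonneg fun i _ => by
      obtain ⟨h0, h1⟩ := hu i
      split_ifs <;> linarith
  have hsum : ∑ x : ι → Bool, (∏ i, if x i = true then u i else 1 - u i) = 1 := by
    have h2 := Finset.prod_univ_sum (fun _ : ι => (Finset.univ : Finset Bool)) fun i b =>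
      if b = true then u i else 1 - u i
    rw [Fintype.piFinset_univ] at h2
    rw [← h2]
    exact Finset.prod_eq_one fun i _ => by simp
  rw [multilinearEval_eq_sum]
  refine ⟨Finset.sum_nonneg fun x _ => mul_nonneg (hw x) (hc x).1, ?_⟩
  exact (Finset.sum_le_sum fun x _ => mul_le_of_le_one_right (hw x) (hc x).2).trans_eq hsum

theorem multilinearEval_zero {ι : Type*} [Fintype ι] [DecidableEq ι] (c : Finset ι → ℝ) :
    (multilinearEval c fun _ => 0) = c ∅ := by
  rw [multilinearEval, Finset.sum_eq_single ∅]
  · simp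
  · intro S _ hS
    simp [Finset.card_ne_zero.mpr (Finset.nonempty_iff_ne_empty.mpr hS)]
  · simp

theorem multilinearEval_single {ι : Type*} [Fintype ι] [DecidableEq ι] (c : Finset ι → ℝ) (j : ι) :
    (multilinearEval c fun i => if i = j then 1 else 0) = c ∅ + c {j} := by
  have h (S : Finset ι) : (∏ i ∈ S, if i = j then (1 : ℝ) else 0) = if S ⊆ {j} then 1 else 0 := by
    rw [Finset.prod_ite_zero]
    simp [Finset.subset_iff]
  simp only [multilinearEval, h, mul_ite, mul_one, mul_zero]
  rw [← Finset.sum_filter]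
  have h2 : (Finset.univ.filter fun S : Finset ι => S ⊆ {j}) = {∅, {j}} := by
    ext S
    simp [Finset.subset_singleton_iff]
  rw [h2, Finset.sum_pair (Finset.singleton_ne_empty j).symm]

open Polynomial in
/-- The total increase of a bounded polynomial along the edges of the cube at the origin is at most
the square of the degree. -/
theorem sum_eval_single_sub_le_sq {ι : Type*} [Fintype ι] [DecidableEq ι] {P : MvPolynomial ι ℝ}
    {D : ℕ} (hD : P.totalDegree ≤ D)
    (hP : ∀ x : ι → Bool, MvPolynomial.eval (fun i => bitReal (x i)) P ∈ Set.Icc (0 : ℝ) 1) :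
    ∑ j, (MvPolynomial.eval (fun i => if i = j then 1 else 0) P - MvPolynomial.eval (fun _ => 0) P)
      ≤ (D : ℝ) ^ 2 := by
  obtain ⟨c, hc, hcP⟩ := exists_multilinearEval P
  have h0 : MvPolynomial.eval (fun _ => 0) P = c ∅ := by
    rw [← multilinearEval_zero c]
    simpa [bitReal] using hcP fun _ => false
  have h1 (j : ι) : MvPolynomial.eval (fun i => if i = j then 1 else 0) P = c ∅ + c {j} := by
    rw [← multilinearEval_single]
    simpa [bitReal] using hcP fun i => decide (i = j)
  -- Restriction to the diagonal: R'(0) is the sum of the linear coefficients, which are the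
  -- increments along the edges at the origin.
  set R : ℝ[X] := ∑ S : Finset ι, C (c S) * X ^ S.card with hR
  have hdeg : R.natDegree ≤ D := by
    refine natDegree_sum_le_of_forall_le _ _ fun S _ => ?_
    by_cases hS : P.totalDegree < S.card
    · simp [hc S hS]
    · exact (natDegree_C_mul_X_pow_le _ _).trans ((not_lt.mp hS).trans hD)
  have heval (t : ℝ) : R.eval t = multilinearEval c fun _ => t := by
    simp [hR, multilinearEval, eval_finsetSum]
  have hderiv : (derivative R).eval 0 = ∑ j, c {j} := by
    have h3 : (derivative R).eval 0 = ∑ S : Finset ι, if S.card = 1 then c S else 0 := by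
      rw [hR, derivative_sum, eval_finsetSum]
      refine Finset.sum_congr rfl fun S _ => ?_
      rw [derivative_C_mul_X_pow]
      rcases hS : S.card with _ | _ | k <;> simp
    rw [h3, ← Finset.sum_filter]
    symm
    refine Finset.sum_bij (fun j _ => {j}) (by simp) (by simp) (fun S hS => ?_) (by simp)
    obtain ⟨j, rfl⟩ := Finset.card_eq_one.mp (Finset.mem_filter.mp hS).2
    exact ⟨j, Finset.mem_univ j, rfl⟩
  have key := eval_zero_derivative_le_sq hdeg fun t ht => by
    rw [heval]
    exact multilinearEval_mem_Icc (fun x => hcP x ▸ hP x) fun _ => ht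
  simpa only [h0, h1, add_sub_cancel_left, hderiv] using key

/-! ### A coordinate separating a point from many others -/

/-- If a bounded polynomial of degree `d` is larger by `1 / 6` on all of `A` than at `z`, then some
coordinate distinguishes `z` from a fraction `Ω(1 / d²)` of the points of `A`. -/
theorem exists_card_le_mul_card_filter_ne {n d : ℕ} {p : MvPolynomial (Fin n) ℝ}
    (hd : p.totalDegree ≤ d) (hp : ∀ x, evalBits p x ∈ Set.Icc (0 : ℝ) 1)
    {A : Finset (Fin n → Bool)} (hA : A.Nonempty) {z : Fin n → Bool}
    (hz : ∀ y ∈ A, evalBits p z + 1 / 6 ≤ evalBits p y) :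
    ∃ i, (A.card : ℝ) ≤ 96 * (d : ℝ) ^ 2 * (A.filter fun y => y i ≠ z i).card := by
  classical
  have hex : ∃ i, ∀ j, (A.filter fun y => y j ≠ z j).card ≤ (A.filter fun y => y i ≠ z i).card := by
    obtain ⟨y, hy⟩ := hA
    have hyz : y ≠ z := by
      rintro rfl
      linarith [hz y hy]
    obtain ⟨i₀, -⟩ := Function.ne_iff.mp hyz
    obtain ⟨i, -, hi⟩ := Finset.exists_max_image Finset.univ
      (fun i => (A.filter fun y => y i ≠ z i).card) ⟨i₀, Finset.mem_univ _⟩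
    exact ⟨i, fun j => hi j (Finset.mem_univ j)⟩
  obtain ⟨i₀, hmax⟩ := hex
  refine ⟨i₀, ?_⟩
  set m := (A.filter fun y => y i₀ ≠ z i₀).card with hm
  have hm1 : 1 ≤ m := by
    obtain ⟨y, hy⟩ := hA
    have hyz : y ≠ z := by
      rintro rfl
      linarith [hz y hy]
    obtain ⟨i, hi⟩ := Function.ne_iff.mp hyz
    exact (Finset.card_pos.mpr ⟨y, Finset.mem_filter.mpr ⟨hy, hi⟩⟩).trans_le (hmax i)
  -- Chosen so that 4m ≤ k² ≤ 16m; the upper bound needs m ≥ 1.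
  set k := 2 * (Nat.sqrt m + 1) with hk
  have hkm : 4 * m ≤ k ^ 2 := by
    have := Nat.lt_succ_sqrt m
    rw [Nat.succ_eq_add_one] at this
    rw [hk]
    nlinarith
  have hkm' : k ^ 2 ≤ 16 * m := by
    have h1 := Nat.sqrt_le m
    have h2 : 1 ≤ Nat.sqrt m := Nat.le_sqrt.mpr (by simpa using hm1)
    rw [hk]
    nlinarith
  obtain ⟨q, hqdeg, hq0, hq1, hq⟩ := exists_polynomial_step (by omega : k ≠ 0) hkm
  obtain ⟨c, hc, hcp⟩ := exists_multilinearEval p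
  -- `L i` counts the selected points that disagree with z at i, at most m by maximality. `U i`
  -- starts from the bit `z i` and flips it as the count goes from 0 to 1, so selecting y alone
  -- produces the bits of y.
  let L (i : Fin n) : MvPolynomial A ℝ := ∑ y : A, if y.1 i ≠ z i then MvPolynomial.X y else 0
  let U (i : Fin n) : MvPolynomial A ℝ :=
    if z i = true then 1 - Polynomial.aeval (L i) q else Polynomial.aeval (L i) q
  let P : MvPolynomial A ℝ := ∑ S : Finset (Fin n), MvPolynomial.C (c S) * ∏ i ∈ S, U i
  have hUdeg (i : Fin n) : (U i).totalDegree ≤ k := by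
    have hL : (L i).totalDegree ≤ 1 := MvPolynomial.totalDegree_finsetSum_le fun y _ => by
      split_ifs
      · simp
      · simp
    have hqL : (Polynomial.aeval (L i) q).totalDegree ≤ k :=
      (totalDegree_polynomial_aeval_le _ _).trans
        ((Nat.mul_le_mul hqdeg hL).trans_eq (mul_one k))
    simp only [U]
    split_ifs
    · exact (MvPolynomial.totalDegree_sub _ _).trans (max_le (by simp) hqL)
    · exact hqL
  have hPdeg : P.totalDegree ≤ d * k := MvPolynomial.totalDegree_finsetSum_le fun S _ => by
    by_cases hS : p.totalDegree < S.card
    · simp [hc S hS]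
    · refine (MvPolynomial.totalDegree_mul _ _).trans ?_
      rw [MvPolynomial.totalDegree_C, zero_add]
      refine (MvPolynomial.totalDegree_finsetProd _ _).trans ?_
      refine (Finset.sum_le_card_nsmul _ _ k fun i _ => hUdeg i).trans ?_
      exact Nat.mul_le_mul_right k ((not_lt.mp hS).trans hd)
  have hLeval (s : A → ℝ) (i : Fin n) :
      MvPolynomial.eval s (L i) = ∑ y : A, if y.1 i ≠ z i then s y else 0 := by
    simp only [L, map_sum, apply_ite (MvPolynomial.eval s), MvPolynomial.eval_X, map_zero]
  have hUeval (s : A → ℝ) (i : Fin n) : MvPolynomial.eval s (U i) =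
      if z i = true then 1 - q.eval (∑ y : A, if y.1 i ≠ z i then s y else 0)
        else q.eval (∑ y : A, if y.1 i ≠ z i then s y else 0) := by
    have h : MvPolynomial.eval s (Polynomial.aeval (L i) q) =
        q.eval (∑ y : A, if y.1 i ≠ z i then s y else 0) := by
      rw [← hLeval, ← MvPolynomial.coe_aeval_eq_eval]
      change MvPolynomial.aeval s _ = _
      rw [← Polynomial.aeval_algHom_apply, Polynomial.coe_aeval_eq_eval]
      rfl
    simp only [U, apply_ite (MvPolynomial.eval s), map_sub, map_one, h]
  have hPeval (s : A → ℝ) :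
      MvPolynomial.eval s P = multilinearEval c fun i => MvPolynomial.eval s (U i) := by
    simp [P, multilinearEval, map_sum, map_prod]
  have hP (x : A → Bool) :
      MvPolynomial.eval (fun y => bitReal (x y)) P ∈ Set.Icc (0 : ℝ) 1 := by
    rw [hPeval]
    refine multilinearEval_mem_Icc (fun w => hcp w ▸ hp w) fun i => ?_
    have hload : (∑ y : A, if y.1 i ≠ z i then bitReal (x y) else 0) ∈ Set.Icc (0 : ℝ) m := by
      refine ⟨Finset.sum_nonneg fun y _ => ?_, ?_⟩
      · split_ifs
        · unfold bitReal
          split_ifs <;> norm_num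
        · exact le_rfl
      · calc (∑ y : A, if y.1 i ≠ z i then bitReal (x y) else 0)
            ≤ ∑ y : A, if y.1 i ≠ z i then (1 : ℝ) else 0 := by
              refine Finset.sum_le_sum fun y _ => ?_
              split_ifs
              · unfold bitReal
                split_ifs <;> norm_num
              · exact le_rfl
          _ = ((A.filter fun y => y i ≠ z i).card : ℝ) := by
              rw [Finset.sum_coe_sort A fun y => if y i ≠ z i then (1 : ℝ) else 0,
                Finset.sum_boole]
          _ ≤ m := by exact_mod_cast hmax i
    obtain ⟨h0, h1⟩ := hq _ hload
    rw [hUeval]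
    split_ifs
    · exact ⟨by linarith, by linarith⟩
    · exact ⟨h0, h1⟩
  have hP0 : MvPolynomial.eval (fun _ => 0) P = evalBits p z := by
    rw [hPeval, evalBits, hcp]
    congr 1
    funext i
    rw [hUeval]
    simp [hq0, bitReal]
  have hP1 (y : A) : MvPolynomial.eval (fun y' => if y' = y then 1 else 0) P = evalBits p y := by
    rw [hPeval, evalBits, hcp]
    congr 1
    funext i
    have h : (∑ y' : A, if y'.1 i ≠ z i then (if y' = y then (1 : ℝ) else 0) else 0) =
        if y.1 i ≠ z i then 1 else 0 := by
      rw [Finset.sum_eq_single y] <;> simp +contextual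
    rw [hUeval, h]
    cases hy : y.1 i <;> cases hzi : z i <;> simp [hq0, hq1, bitReal]
  have key := sum_eval_single_sub_le_sq hPdeg hP
  have hlow : (A.card : ℝ) * (1 / 6) ≤ ∑ y : A,
      (MvPolynomial.eval (fun y' => if y' = y then 1 else 0) P -
        MvPolynomial.eval (fun _ => 0) P) := by
    have := Finset.card_nsmul_le_sum (Finset.univ : Finset A) (fun y =>
      MvPolynomial.eval (fun y' => if y' = y then 1 else 0) P -
        MvPolynomial.eval (fun _ => 0) P) (1 / 6) fun y _ => by
          rw [hP0, hP1]
          linarith [hz y.1 y.2]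
    simpa using this
  have hk16 : (k : ℝ) ^ 2 ≤ 16 * m := by exact_mod_cast hkm'
  push_cast at key
  -- |A|/6 ≤ (dk)² ≤ 16d²m, and 96 = 6 · 16.
  nlinarith [mul_le_mul_of_nonneg_left hk16 (sq_nonneg (d : ℝ))]

/-! ### Building the decision tree -/

/-- Some query shrinks the number of pairs that remain to be separated, whatever its answer. -/
theorem exists_query_shrinking {n d : ℕ} {p : MvPolynomial (Fin n) ℝ}
    (hd : p.totalDegree ≤ d) (hp : ∀ x, evalBits p x ∈ Set.Icc (0 : ℝ) 1)
    {A : Bool → Finset (Fin n → Bool)} (hA : ∀ c, (A c).Nonempty)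
    (hApp : ∀ c, ∀ y ∈ A c, |evalBits p y - bitReal c| ≤ 1 / 3) :
    1 ≤ d ∧ ∃ i, ∀ b, (((A false).filter fun y => y i = b).card : ℝ) *
        ((A true).filter fun y => y i = b).card ≤
      (1 - 1 / (96 * (d : ℝ) ^ 2)) * ((A false).card * (A true).card) := by
  have hfar (z : Fin n → Bool) :
      ∃ c i, ((A c).card : ℝ) ≤ 96 * (d : ℝ) ^ 2 * ((A c).filter fun y => y i ≠ z i).card := by
    rcases le_total (evalBits p z) (1 / 2) with h | h
    · obtain ⟨i, hi⟩ := exists_card_le_mul_card_filter_ne hd hp (hA true) (z := z) fun y hy => by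
        have := (abs_le.mp (hApp true y hy)).1
        simp only [bitReal, if_true] at this
        linarith
      exact ⟨true, i, hi⟩
    · have h1 (x : Fin n → Bool) : evalBits (1 - p) x = 1 - evalBits p x := by simp [evalBits]
      obtain ⟨i, hi⟩ := exists_card_le_mul_card_filter_ne (p := 1 - p) (d := d)
        ((MvPolynomial.totalDegree_sub _ _).trans (max_le (by simp) hd))
        (fun x => by
          obtain ⟨h2, h3⟩ := hp x
          rw [h1]
          exact ⟨by linarith, by linarith⟩) (hA false) (z := z) fun y hy => by
        have := (abs_le.mp (hApp false y hy)).2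
        simp only [bitReal, Bool.false_eq_true, if_false] at this
        rw [h1, h1]
        linarith
      exact ⟨false, i, hi⟩
  have hpos (c : Bool) : (0 : ℝ) < (A c).card := by exact_mod_cast (hA c).card_pos
  have hd1 : 1 ≤ d := by
    by_contra h
    obtain rfl : d = 0 := by omega
    obtain ⟨c, i, hi⟩ := hfar fun _ => false
    have := hpos c
    simp at hi
    simp [hi] at this
  refine ⟨hd1, ?_⟩
  by_contra hcon
  push Not at hcon
  -- The bad answers to the individual queries assemble into one point z, which need not lie in the
  -- domain; hence the need for p to be bounded on the whole cube.
  choose z hz using hcon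
  obtain ⟨c, i, hi⟩ := hfar z
  have hdpos : (0 : ℝ) < 96 * (d : ℝ) ^ 2 := by positivity
  have hsplit : (((A c).filter fun y => y i = z i).card : ℝ) +
      ((A c).filter fun y => y i ≠ z i).card = (A c).card := by
    exact_mod_cast Finset.card_filter_add_card_filter_not (s := A c) fun y => y i = z i
  have hle (c' : Bool) : (((A c').filter fun y => y i = z i).card : ℝ) ≤ (A c').card := by
    exact_mod_cast Finset.card_filter_le _ _
  have hshrink : (((A c).filter fun y => y i = z i).card : ℝ) ≤
      (1 - 1 / (96 * (d : ℝ) ^ 2)) * (A c).card := by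
    have : 1 / (96 * (d : ℝ) ^ 2) * (A c).card ≤ ((A c).filter fun y => y i ≠ z i).card := by
      rw [one_div, inv_mul_le_iff₀ hdpos]
      exact hi
    linarith
  refine (hz i).not_ge ?_
  cases c
  · rw [← mul_assoc]
    exact mul_le_mul hshrink (hle true) (by positivity) ((Nat.cast_nonneg _).trans hshrink)
  · rw [mul_left_comm]
    exact mul_le_mul (hle false) hshrink (by positivity) (by positivity)

/-- Points of the cube that are told apart by a bounded polynomial of degree `d` are told apart by a
shallow decision tree. -/
theorem exists_decisionTree_separating {n d : ℕ} {p : MvPolynomial (Fin n) ℝ}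
    (hd : p.totalDegree ≤ d) (hp : ∀ x, evalBits p x ∈ Set.Icc (0 : ℝ) 1)
    (A : Bool → Finset (Fin n → Bool))
    (hApp : ∀ c, ∀ y ∈ A c, |evalBits p y - bitReal c| ≤ 1 / 3) :
    ∃ T : DecisionTree n, (∀ c, ∀ y ∈ A c, T.eval y = c) ∧
      (T.depth = 0 ∨ (∀ c, (A c).Nonempty) ∧ 1 ≤ d ∧
        (T.depth : ℝ) ≤ 96 * (d : ℝ) ^ 2 * Real.log ((A false).card * (A true).card) + 1) := by
  induction hN : (A false).card * (A true).card using Nat.strong_induction_on generalizing A with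
  | _ N ih =>
  by_cases hA : ∀ c, (A c).Nonempty
  swap
  · push Not at hA
    obtain ⟨c, hc⟩ := hA
    -- Side c is empty, so the other bit is always correct.
    refine ⟨.leaf !c, fun c' y hy => ?_, Or.inl rfl⟩
    cases c <;> cases c' <;> simp_all [DecisionTree.eval]
  obtain ⟨hd1, i, hi⟩ := exists_query_shrinking hd hp hA hApp
  have hdpos : (0 : ℝ) < 96 * (d : ℝ) ^ 2 := by positivity
  set δ : ℝ := 1 / (96 * (d : ℝ) ^ 2) with hδ
  have hδ0 : 0 < δ := by positivity
  have hpos (c : Bool) : (1 : ℝ) ≤ (A c).card := by exact_mod_cast (hA c).card_pos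
  have hNpos : (1 : ℝ) ≤ (A false).card * (A true).card := one_le_mul_of_one_le_of_one_le
    (hpos false) (hpos true)
  -- Since log(1 - δ) ≤ -δ, a query lowers the logarithm of the potential by at least δ, which pays
  -- for one level as 96d²δ = 1. If a side becomes empty there is no such gain, but the subtree has
  -- depth 0; the extra 1 in the bound covers the query leading to it.
  have hsub (b : Bool) : ∃ T : DecisionTree n, (∀ c, ∀ y ∈ A c, y i = b → T.eval y = c) ∧
      (T.depth : ℝ) ≤ 96 * (d : ℝ) ^ 2 * Real.log ((A false).card * (A true).card) := by
    have hlt : ((A false).filter fun y => y i = b).card * ((A true).filter fun y => y i = b).card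
        < N := by
      rw [← hN]
      have : (((A false).filter fun y => y i = b).card : ℝ) *
          ((A true).filter fun y => y i = b).card < (A false).card * (A true).card :=
        (hi b).trans_lt (by nlinarith)
      exact_mod_cast this
    obtain ⟨T, hT, hdepth⟩ := ih _ hlt (fun c => (A c).filter fun y => y i = b)
      (fun c y hy => hApp c y (Finset.mem_filter.mp hy).1) rfl
    refine ⟨T, fun c y hy hyi => hT c y (Finset.mem_filter.mpr ⟨hy, hyi⟩), ?_⟩
    rcases hdepth with h0 | ⟨hne, -, hdepth⟩
    · rw [h0]
      have := Real.log_nonneg hNpos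
      push_cast
      positivity
    · have hpos' (c : Bool) : (0 : ℝ) < ((A c).filter fun y => y i = b).card := by
        exact_mod_cast (hne c).card_pos
      have hprod := mul_pos (hpos' false) (hpos' true)
      have h1δ : 0 < 1 - δ := by
        by_contra h
        have := hprod.trans_le (hi b)
        nlinarith
      have hlog : Real.log ((((A false).filter fun y => y i = b).card : ℝ) *
          ((A true).filter fun y => y i = b).card) ≤
          Real.log ((A false).card * (A true).card) - δ := by
        have h1 := Real.log_le_log hprod (hi b)
        rw [Real.log_mul h1δ.ne' (by positivity)] at h1
        linarith [Real.log_le_sub_one_of_pos h1δ]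
      have hmul := mul_le_mul_of_nonneg_left hlog hdpos.le
      have hδ1 : 96 * (d : ℝ) ^ 2 * δ = 1 := by
        rw [hδ]
        field_simp
      rw [mul_sub, hδ1] at hmul
      linarith
  obtain ⟨T₀, hT₀, hd₀⟩ := hsub false
  obtain ⟨T₁, hT₁, hd₁⟩ := hsub true
  refine ⟨.query i T₀ T₁, fun c y hy => ?_, Or.inr ⟨hA, hd1, ?_⟩⟩
  · rw [DecisionTree.eval]
    split_ifs with h
    · exact hT₁ c y hy h
    · exact hT₀ c y hy (by simpa using h)
  · rw [DecisionTree.depth]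
    push_cast
    linarith [max_le hd₀ hd₁]

/-! ### Existence of approximants and conclusion -/

/-- Interpolation on the cube, with value 0 outside the domain. It makes the infimum defining the
approximate degree one over a nonempty set, hence attained. -/
theorem exists_approximatesBounded {n : ℕ} {ε : ℝ} (hε : 0 ≤ ε) (f : PartialBoolFun n) :
    ∃ p : MvPolynomial (Fin n) ℝ, ApproximatesBounded ε p f := by
  let ind (a : Fin n → Bool) : MvPolynomial (Fin n) ℝ :=
    ∏ i, if a i = true then MvPolynomial.X i else 1 - MvPolynomial.X i
  let v (a : Fin n → Bool) : ℝ := bitReal ((f a).getD false)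
  have hind (a x : Fin n → Bool) : evalBits (ind a) x = if a = x then 1 else 0 := by
    have h (i : Fin n) : MvPolynomial.eval (fun i => bitReal (x i))
        (if a i = true then MvPolynomial.X i else 1 - MvPolynomial.X i) =
        if a i = x i then 1 else 0 := by
      cases ha : a i <;> cases hx : x i <;> simp [hx, bitReal]
    simp only [evalBits, ind, map_prod, h, Finset.prod_ite_zero, Finset.mem_univ, true_implies,
      Finset.prod_const_one, funext_iff]
  have heval (x : Fin n → Bool) :
      evalBits (∑ a : Fin n → Bool, MvPolynomial.C (v a) * ind a) x = v x := by
    have : evalBits (∑ a : Fin n → Bool, MvPolynomial.C (v a) * ind a) x =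
        ∑ a : Fin n → Bool, v a * evalBits (ind a) x := by
      simp [evalBits]
    simp [this, hind]
  refine ⟨∑ a : Fin n → Bool, MvPolynomial.C (v a) * ind a, fun x b hx => ?_, fun x => ?_⟩
  · simpa [heval, v, hx] using hε
  · rw [heval]
    simp only [v, bitReal]
    split_ifs <;> simp

theorem exists_approximatesBounded_totalDegree_eq {n : ℕ} (f : PartialBoolFun n) :
    ∃ p : MvPolynomial (Fin n) ℝ, ApproximatesBounded (1 / 3) p f ∧
      p.totalDegree = approxDegree f := by
  obtain ⟨p, hp⟩ := exists_approximatesBounded (ε := 1 / 3) (by norm_num) f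
  exact Nat.sInf_mem (s := {d : ℕ | ∃ p : MvPolynomial (Fin n) ℝ,
    ApproximatesBounded (1 / 3) p f ∧ p.totalDegree = d}) ⟨_, p, hp, rfl⟩

theorem mainTheorem11 :
    ∃ C : ℝ, 0 < C ∧ ∀ (n : ℕ) (f : PartialBoolFun n),
      (detQueryComplexity f : ℝ) ≤
        C * (approxDegree f : ℝ) ^ 2 * (Real.logb 2 (f.dom.card : ℝ)) ^ 2 := by
  -- 193 = 2 · 96 + 1: the 2 comes from |A₀|·|A₁| ≤ |Dom f|², the 1 from absorbing the additive 1.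
  refine ⟨193, by norm_num, fun n f => ?_⟩
  obtain ⟨p, ⟨happ, hp⟩, hdeg⟩ := exists_approximatesBounded_totalDegree_eq f
  set d := approxDegree f
  let A (c : Bool) : Finset (Fin n → Bool) := Finset.univ.filter fun x => f x = some c
  obtain ⟨T, hT, hdepth⟩ := exists_decisionTree_separating hdeg.le hp A fun c y hy =>
    happ y c (Finset.mem_filter.mp hy).2
  have hD : detQueryComplexity f ≤ T.depth :=
    Nat.sInf_le ⟨T, fun x b hx => hT b x (Finset.mem_filter.mpr ⟨Finset.mem_univ x, hx⟩), rfl⟩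
  have hD' : (detQueryComplexity f : ℝ) ≤ T.depth := by exact_mod_cast hD
  refine hD'.trans ?_
  rcases hdepth with h0 | ⟨hne, hd1, hdepth⟩
  -- Depth 0 includes every f with an empty side, in particular the nowhere defined one; below, both
  -- sides are nonempty, so log₂|Dom f| ≥ 1.
  · rw [h0]
    push_cast
    positivity
  have hdom : (A false).card + (A true).card = f.dom.card := by
    rw [← Finset.card_union_of_disjoint]
    · congr 1
      ext x
      rcases hx : f x with _ | b
      · simp [A, PartialBoolFun.dom, hx]
      · cases b <;> simp [A, PartialBoolFun.dom, hx]
    · refine Finset.disjoint_left.mpr fun x h1 h2 => ?_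
      simp_all [A]
  have hpos (c : Bool) : (1 : ℝ) ≤ (A c).card := by exact_mod_cast (hne c).card_pos
  have hdomR : ((A false).card : ℝ) + (A true).card = f.dom.card := by exact_mod_cast hdom
  set N : ℝ := (f.dom.card : ℝ)
  have hN2 : 2 ≤ N := by linarith [hpos false, hpos true]
  have hb1 : 1 ≤ Real.logb 2 N := by
    rw [Real.le_logb_iff_rpow_le (by norm_num) (by linarith)]
    simpa using hN2
  have hlogN : Real.log N ≤ Real.logb 2 N := by
    rw [Real.logb, le_div_iff₀ (Real.log_pos (by norm_num))]
    have h1 := Real.log_nonneg (by linarith : (1 : ℝ) ≤ N)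
    have h2 := Real.log_two_lt_d9
    nlinarith
  have hlog : Real.log ((A false).card * (A true).card) ≤ 2 * Real.logb 2 N := by
    have h1 : Real.log ((A false).card * (A true).card) ≤ Real.log (N * N) := by
      refine Real.log_le_log (by nlinarith [hpos false, hpos true]) ?_
      exact mul_le_mul (by linarith [hpos true]) (by linarith [hpos false])
        (by positivity) (by linarith)
    rw [Real.log_mul (x := N) (y := N) (by linarith) (by linarith)] at h1
    linarith
  have hdR : (1 : ℝ) ≤ d := by exact_mod_cast hd1
  have hd2 : (1 : ℝ) ≤ (d : ℝ) ^ 2 := one_le_pow₀ hdR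
  have hsq : Real.logb 2 N ≤ Real.logb 2 N ^ 2 := by nlinarith
  calc (T.depth : ℝ) ≤ 96 * (d : ℝ) ^ 2 * (2 * Real.logb 2 N ^ 2) + 1 :=
        hdepth.trans (by gcongr; linarith)
    _ ≤ 96 * (d : ℝ) ^ 2 * (2 * Real.logb 2 N ^ 2) + (d : ℝ) ^ 2 * Real.logb 2 N ^ 2 := by
        gcongr
        exact one_le_mul_of_one_le_of_one_le hd2 (by linarith)
    _ = 193 * (d : ℝ) ^ 2 * Real.logb 2 N ^ 2 := by ring
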